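/- Let $p$ be a prime number, let $d \ge 0$ be an integer, and let $P \subset \mathbb{R}^d$ be a lattice polytope (a convex polytope all of whose vertices lie in $\mathbb{Z}^d$) of dimension $d$ whose normalized volume $d!\cdot\mathrm{vol}(P)$ equals $p$. Suppose that $P$ is not an empty simplex, i.e. $P$ is not a simplex whose only lattice points are its vertices. Then $P$ is spanning: the affine sublattice of $\mathbb{Z}^d$ generated by $P \cap \mathbb{Z}^d$ (the set of all integer affine combinations of points of $P \cap \mathbb{Z}^d$) has index $1$ in $\mathbb{Z}^d$. -/

import Mathlib

open MeasureTheory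
open scoped Nat

namespace LatticePolytope

/-- The inclusion `ℤ^d → ℝ^d`. -/
def latticeEmb (d : ℕ) (z : Fin d → ℤ) : Fin d → ℝ := fun i => (z i : ℝ)

/-- A convex polytope in `ℝ^d`: the convex hull of finitely many points. -/
def IsConvexPolytope {d : ℕ} (P : Set (Fin d → ℝ)) : Prop :=
  ∃ S : Set (Fin d → ℝ), S.Finite ∧ P = convexHull ℝ S

/-- A lattice polytope: a convex polytope all of whose vertices (extreme points) lie in `ℤ^d`. -/
def IsLatticePolytope {d : ℕ} (P : Set (Fin d → ℝ)) : Prop :=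
  IsConvexPolytope P ∧ P.extremePoints ℝ ⊆ Set.range (latticeEmb d)

/-- The dimension of `P`, i.e. the dimension of its affine hull. -/
noncomputable def dim {d : ℕ} (P : Set (Fin d → ℝ)) : ℕ :=
  Module.finrank ℝ (vectorSpan ℝ P)

/-- The normalized volume `d! · vol(P)` of `P ⊆ ℝ^d`. -/
noncomputable def normalizedVolume {d : ℕ} (P : Set (Fin d → ℝ)) : ℝ :=
  (d ! : ℝ) * (volume P).toReal

/-- The set `P ∩ ℤ^d`, as a set of integer vectors. -/
def latticePoints {d : ℕ} (P : Set (Fin d → ℝ)) : Set (Fin d → ℤ) :=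
  {z | latticeEmb d z ∈ P}

/-- The affine sublattice of `ℤ^d` generated by `P ∩ ℤ^d`: all integer affine combinations of
lattice points of `P`. -/
def affineLattice {d : ℕ} (P : Set (Fin d → ℝ)) : AffineSubspace ℤ (Fin d → ℤ) :=
  affineSpan ℤ (latticePoints P)

/-- The index of `P`: the index in `ℤ^d` of the affine sublattice generated by `P ∩ ℤ^d`, that is,
of the subgroup of which it is a translate. (It is `0` if that index is infinite.) -/
noncomputable def index {d : ℕ} (P : Set (Fin d → ℝ)) : ℕ :=
  (affineLattice P).direction.toAddSubgroup.index

/-- `P` is spanning if its index is `1`. -/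
def IsSpanning {d : ℕ} (P : Set (Fin d → ℝ)) : Prop :=
  index P = 1

/-- An empty simplex: a lattice polytope that is a simplex (the convex hull of affinely independent
points, its vertices) and contains no lattice points other than its vertices. -/
def IsEmptySimplex {d : ℕ} (P : Set (Fin d → ℝ)) : Prop :=
  IsLatticePolytope P ∧
    ∃ (n : ℕ) (s : Affine.Simplex ℝ (Fin d → ℝ) n),
      P = convexHull ℝ (Set.range s.points) ∧
      ∀ z ∈ latticePoints P, latticeEmb d z ∈ Set.range s.points

end LatticePolytope

/-!
Let `q` be the index of `P`. A lattice simplex with vertices in `P` has as normalized volume the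
absolute value of a determinant whose rows lie in a sublattice of index `q`, so this volume is a
multiple of `q`. As `P` is triangulated by such simplices, `q` divides `p`. If `q = p`, then every
full-dimensional simplex with vertices among the lattice points of `P` already has volume at least
`p`, so it is all of `P`. Every lattice point of `P` is a vertex of such a simplex, hence an extreme
point of `P`, and `P` is an empty simplex.

The triangulation is the lower hull of generic heights `ω` on the vertices. A point `x` in general
position is covered: among the simplices containing `x`, one whose affine interpolation of `ω` is
smallest at `x` admits no improving pivot of the simplex method, so it is a cell. It is covered only
once: the affine functions of two cells containing `x` take the same value at `x`, hence coincide.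
-/

namespace LatticePolytope

section AffineSpan

variable {𝕜 E P : Type*} [AddCommGroup E] [AddTorsor E P]

theorem exists_sum_smul_eq_of_mem_affineSpan [Ring 𝕜] [Module 𝕜 E] {σ : Finset E} {a : E}
    (ha : a ∈ affineSpan 𝕜 (σ : Set E)) :
    ∃ w : E → 𝕜, ∑ e ∈ σ, w e = 1 ∧ ∑ e ∈ σ, w e • e = a := by
  classical
  rw [← Subtype.range_coe (s := (σ : Set E))] at ha
  obtain ⟨w, hw, rfl⟩ := eq_affineCombination_of_mem_affineSpan_of_fintype ha
  refine ⟨fun e => if h : e ∈ σ then w ⟨e, h⟩ else 0, ?_, ?_⟩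
  · simpa [← Finset.sum_coe_sort σ] using hw
  · rw [← Finset.sum_coe_sort, Finset.affineCombination_eq_linear_combination _ _ _ hw]
    simp

theorem notMem_affineSpan_sdiff_singleton [Ring 𝕜] [Module 𝕜 E] [Nontrivial 𝕜] {s : Set P}
    (hs : AffineIndependent 𝕜 ((↑) : s → P)) {b : P} (hb : b ∈ s) :
    b ∉ affineSpan 𝕜 (s \ {b}) := by
  simpa [Set.image_sdiff Subtype.val_injective] using
    hs.notMem_affineSpan_sdiff ⟨b, hb⟩ Set.univ

theorem exists_affineMap_eqOn [CommRing 𝕜] [Module 𝕜 E] {σ : Finset P}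
    (hind : AffineIndependent 𝕜 ((↑) : σ → P)) (htop : affineSpan 𝕜 (σ : Set P) = ⊤)
    (ω : P → 𝕜) : ∃ h : P →ᵃ[𝕜] 𝕜, Set.EqOn h ω σ := by
  classical
  let b : AffineBasis σ 𝕜 P := ⟨(↑), hind, by simpa using htop⟩
  refine ⟨(Fintype.linearCombination 𝕜 fun i : σ => ω i).toAffineMap.comp b.coords,
    fun a ha => ?_⟩
  have hcoord (i : σ) : b.coord i a = if i = ⟨a, ha⟩ then 1 else 0 := b.coord_apply i ⟨a, ha⟩
  simp [Fintype.linearCombination_apply, hcoord]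

end AffineSpan

section Convexity

variable {𝕜 E : Type*} [Field 𝕜] [LinearOrder 𝕜] [IsStrictOrderedRing 𝕜] [AddCommGroup E]
  [Module 𝕜 E]

theorem affineMap_nonneg_of_mem_convexHull {f : E →ᵃ[𝕜] 𝕜} {s : Set E} (hf : ∀ a ∈ s, 0 ≤ f a)
    {x : E} (hx : x ∈ convexHull 𝕜 s) : 0 ≤ f x :=
  convexHull_min (t := f ⁻¹' Set.Ici 0) hf ((convex_Ici 0).affine_preimage f) hx

theorem mem_convexHull_setOf_affineMap_eq_zero {f : E →ᵃ[𝕜] 𝕜} {s : Set E}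
    (hf : ∀ a ∈ s, 0 ≤ f a) {x : E} (hx : x ∈ convexHull 𝕜 s) (hfx : f x ≤ 0) :
    x ∈ convexHull 𝕜 {a ∈ s | f a = 0} := by
  set Z : Set E := {a ∈ s | f a = 0}
  have hconv : Convex 𝕜 {y | 0 ≤ f y ∧ (f y ≤ 0 → y ∈ convexHull 𝕜 Z)} := by
    refine convex_iff_forall_pos.2 ?_
    rintro y ⟨hy, hyZ⟩ z ⟨hz, hzZ⟩ a b ha hb hab
    have hcombo : f (a • y + b • z) = a * f y + b * f z := Convex.combo_affine_apply hab
    have hay := mul_nonneg ha.le hy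
    have hbz := mul_nonneg hb.le hz
    refine ⟨hcombo ▸ add_nonneg hay hbz, fun hle => ?_⟩
    rw [hcombo] at hle
    exact convex_convexHull 𝕜 Z (hyZ (nonpos_of_mul_nonpos_right (by linarith) ha))
      (hzZ (nonpos_of_mul_nonpos_right (by linarith) hb)) ha.le hb.le hab
  have hsub : s ⊆ {y | 0 ≤ f y ∧ (f y ≤ 0 → y ∈ convexHull 𝕜 Z)} := fun a ha =>
    ⟨hf a ha, fun hle => subset_convexHull 𝕜 Z ⟨ha, hle.antisymm (hf a ha)⟩⟩
  exact (convexHull_min hsub hconv hx).2 hfx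

theorem exists_mem_convexHull_insert_erase [DecidableEq E] {σ : Finset E} {x a : E}
    (hx : x ∈ convexHull 𝕜 (σ : Set E)) (ha : a ∈ affineSpan 𝕜 (σ : Set E)) :
    ∃ b ∈ σ, x ∈ convexHull 𝕜 ((insert a (σ.erase b) : Finset E) : Set E) := by
  obtain ⟨w, hw0, hw1, hwx⟩ := Finset.mem_convexHull'.1 hx
  obtain ⟨g, hg1, hga⟩ := exists_sum_smul_eq_of_mem_affineSpan ha
  obtain ⟨c, hc, hgc⟩ : ∃ c ∈ σ, 0 < g c :=
    Finset.exists_lt_of_sum_lt (f := fun _ => (0 : 𝕜)) (by simp [hg1])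
  obtain ⟨b, hb, hmin⟩ := (σ.filter (0 < g ·)).exists_min_image (fun e => w e / g e)
    ⟨c, Finset.mem_filter.2 ⟨hc, hgc⟩⟩
  obtain ⟨hbσ, hgb⟩ := Finset.mem_filter.1 hb
  set t := w b / g b
  have ht : 0 ≤ t := div_nonneg (hw0 b hbσ) hgb.le
  have hpos : ∀ e ∈ σ, 0 ≤ w e - t * g e := fun e he => by
    rcases le_or_gt (g e) 0 with hge | hge
    · exact sub_nonneg.2 ((mul_nonpos_of_nonneg_of_nonpos ht hge).trans (hw0 e he))
    · exact sub_nonneg.2 ((le_div_iff₀ hge).1 (hmin e (Finset.mem_filter.2 ⟨he, hge⟩)))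
  have hb0 : w b - t * g b = 0 := by rw [div_mul_cancel₀ _ hgb.ne', sub_self]
  have hsum : ∑ e ∈ σ, ((w e - t * g e) + if e = b then t else 0) = 1 := by
    simp [Finset.sum_add_distrib, Finset.sum_sub_distrib, ← Finset.mul_sum, hw1, hg1, hbσ]
  have hsum' : ∑ e ∈ σ, ((w e - t * g e) + if e = b then t else 0) •
      (if e = b then a else e) = x := by
    calc _ = ∑ e ∈ σ, ((w e - t * g e) • e + if e = b then t • a else 0) := by
          refine Finset.sum_congr rfl fun e _ => ?_
          by_cases h : e = b
          · simp [h, hb0]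
          · simp [h]
      _ = x := by
          simp [Finset.sum_add_distrib, sub_smul, mul_smul, ← Finset.smul_sum, hga, hwx, hbσ]
  refine ⟨b, hbσ, hsum' ▸ (convex_convexHull 𝕜 _).sum_mem (fun e he => ?_) hsum fun e he => ?_⟩
  · exact add_nonneg (hpos e he) (by split_ifs <;> simp [ht])
  · refine subset_convexHull 𝕜 _ ?_
    split_ifs with h <;> simp [h, he]

end Convexity

section GenericPosition

variable {𝕜 E : Type*} [Field 𝕜] [AddCommGroup E] [Module 𝕜 E]

/-- Heights `ω` on the points of `S` that are generic, so that they induce a triangulation: an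
affine function interpolating `ω` on an affinely spanning subset `τ` of `S` agrees with `ω` at no
point of `S` outside `τ`. -/
def IsGenericHeight (ω : E → 𝕜) (S : Finset E) : Prop :=
  ∀ τ ⊆ S, affineSpan 𝕜 (τ : Set E) = ⊤ → ∀ h : E →ᵃ[𝕜] 𝕜, Set.EqOn h ω τ →
    ∀ a ∈ S, h a = ω a → a ∈ τ

/-- The heights that some affine function interpolates at `a` and at all points of `τ`. -/
def interpolableHeights (τ : Set E) (a : E) : Subspace 𝕜 (E → 𝕜) where
  carrier := {ω | ∃ h : E →ᵃ[𝕜] 𝕜, Set.EqOn h ω (insert a τ)}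
  zero_mem' := ⟨0, fun _ _ => rfl⟩
  add_mem' := by
    rintro _ _ ⟨h, hh⟩ ⟨k, hk⟩
    exact ⟨h + k, fun b hb => by simp [hh hb, hk hb]⟩
  smul_mem' := by
    rintro c _ ⟨h, hh⟩
    exact ⟨c • h, fun b hb => by simp [hh hb]⟩

theorem interpolableHeights_ne_top {τ : Set E} (hτ : affineSpan 𝕜 τ = ⊤) {a : E} (ha : a ∉ τ) :
    interpolableHeights (𝕜 := 𝕜) τ a ≠ ⊤ := fun htop => by
  classical
  obtain ⟨h, hh⟩ : Pi.single a 1 ∈ interpolableHeights (𝕜 := 𝕜) τ a := htop ▸ Submodule.mem_top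
  have h_zero : h = 0 := AffineMap.ext_on hτ fun b hb => by
    rw [hh (Set.mem_insert_of_mem a hb), Pi.single_eq_of_ne (ne_of_mem_of_not_mem hb ha)]
    rfl
  simpa [h_zero] using hh (Set.mem_insert a τ)

theorem exists_isGenericHeight [Infinite 𝕜] (S : Finset E) : ∃ ω : E → 𝕜, IsGenericHeight ω S := by
  classical
  let I := (S.powerset ×ˢ S).filter fun q => affineSpan 𝕜 (q.1 : Set E) = ⊤ ∧ q.2 ∉ q.1
  let K (q : Finset E × E) : Subspace 𝕜 (E → 𝕜) := interpolableHeights q.1 q.2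
  have htop : ⊤ ∉ I.image K := fun hmem => by
    obtain ⟨q, hq, hK⟩ := Finset.mem_image.1 hmem
    obtain ⟨-, hspan, ha⟩ := Finset.mem_filter.1 hq
    exact interpolableHeights_ne_top hspan (by simpa using ha) hK
  obtain ⟨ω, hω⟩ :=
    (Set.ne_univ_iff_exists_notMem _).1 (Subspace.biUnion_ne_univ_of_top_notMem htop)
  refine ⟨ω, fun τ hτS hspan h hτ a haS ha => by_contra fun haτ => hω ?_⟩
  have hI : (τ, a) ∈ I := Finset.mem_filter.2
    ⟨Finset.mem_product.2 ⟨Finset.mem_powerset.2 hτS, haS⟩, hspan, haτ⟩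
  exact Set.mem_biUnion (Finset.mem_coe.2 (Finset.mem_image_of_mem K hI))
    ⟨h, Set.forall_mem_insert.2 ⟨ha, hτ⟩⟩

/-- A point `x` in general position with respect to `S`: it lies on no proper affine subspace
spanned by points of `S`. -/
def InGeneralPosition (𝕜 : Type*) {E : Type*} [Field 𝕜] [AddCommGroup E] [Module 𝕜 E]
    (x : E) (S : Finset E) : Prop :=
  ∀ τ ⊆ S, x ∈ affineSpan 𝕜 (τ : Set E) → affineSpan 𝕜 (τ : Set E) = ⊤

end GenericPosition

section RegularTriangulation

variable {𝕜 E : Type*} [Field 𝕜] [LinearOrder 𝕜] [IsStrictOrderedRing 𝕜] [AddCommGroup E]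
  [Module 𝕜 E]

/-- The vertex sets `σ ⊆ S` of the cells of the regular subdivision of `S` with heights `ω`: those
for which the points of `S` lifted to the heights `ω` lie on or above the graph of an affine
function, the lifts of `σ` being exactly those on the graph. -/
def IsRegularCell (ω : E → 𝕜) (S σ : Finset E) : Prop :=
  σ ⊆ S ∧ ∃ h : E →ᵃ[𝕜] 𝕜, Set.EqOn h ω σ ∧ ∀ a ∈ S, a ∉ σ → h a < ω a

theorem isRegularCell_unique {ω : E → 𝕜} {S σ τ : Finset E} (hσ : IsRegularCell ω S σ)
    (hτ : IsRegularCell ω S τ) {x : E} (hx : InGeneralPosition 𝕜 x S)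
    (hxσ : x ∈ convexHull 𝕜 (σ : Set E)) (hxτ : x ∈ convexHull 𝕜 (τ : Set E)) : σ = τ := by
  classical
  obtain ⟨hσS, h, hhσ, hlt⟩ := hσ
  obtain ⟨hτS, k, hkτ, klt⟩ := hτ
  have hle : ∀ a ∈ S, h a ≤ ω a := fun a ha =>
    if haσ : a ∈ σ then (hhσ haσ).le else (hlt a ha haσ).le
  have kle : ∀ a ∈ S, k a ≤ ω a := fun a ha =>
    if haτ : a ∈ τ then (hkτ haτ).le else (klt a ha haτ).le
  have hkh : ∀ a ∈ (τ : Set E), 0 ≤ (k - h) a := fun a ha => by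
    simpa [hkτ ha] using hle a (hτS ha)
  have hhk : ∀ a ∈ (σ : Set E), 0 ≤ (h - k) a := fun a ha => by
    simpa [hhσ ha] using kle a (hσS ha)
  have hkhx : (k - h) x ≤ 0 := by simpa using affineMap_nonneg_of_mem_convexHull hhk hxσ
  have hxZ := mem_convexHull_setOf_affineMap_eq_zero hkh hxτ hkhx
  have hspan : affineSpan 𝕜 {a ∈ (τ : Set E) | (k - h) a = 0} = ⊤ := by
    have := hx (τ.filter fun a => (k - h) a = 0) ((τ.filter_subset _).trans hτS)
    rw [Finset.coe_filter] at this
    exact this (convexHull_subset_affineSpan _ hxZ)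
  obtain rfl : k = h := AffineMap.ext_on hspan fun a ha => sub_eq_zero.1 ha.2
  ext a
  exact ⟨fun ha => by_contra fun haτ => (klt a (hσS ha) haτ).ne (hhσ ha),
    fun ha => by_contra fun haσ => (hlt a (hτS ha) haσ).ne (hkτ ha)⟩

theorem exists_affineIndependent_mem_convexHull {S : Finset E} {x : E}
    (hx : x ∈ convexHull 𝕜 (S : Set E)) : ∃ σ ⊆ S,
      AffineIndependent 𝕜 ((↑) : σ → E) ∧ x ∈ convexHull 𝕜 (σ : Set E) := by
  rw [convexHull_eq_union] at hx
  simp only [Set.mem_iUnion, Finset.coe_subset] at hx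
  obtain ⟨σ, hσS, hind, hxσ⟩ := hx
  exact ⟨σ, hσS, hind, hxσ⟩

-- The pivot step of the simplex method: `a` enters the vertex set and another point leaves it.
theorem exists_affineIndependent_apply_lt {ω : E → 𝕜} {σ : Finset E}
    (hσ : AffineIndependent 𝕜 ((↑) : σ → E)) {x : E} (hx : InGeneralPosition 𝕜 x σ)
    (hxσ : x ∈ convexHull 𝕜 (σ : Set E)) {h : E →ᵃ[𝕜] 𝕜} (hh : Set.EqOn h ω σ) {a : E}
    (ha : ω a < h a) :
    ∃ τ : Finset E, (∀ e ∈ τ, e = a ∨ e ∈ σ) ∧ AffineIndependent 𝕜 ((↑) : τ → E) ∧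
      x ∈ convexHull 𝕜 (τ : Set E) ∧ ∀ k : E →ᵃ[𝕜] 𝕜, Set.EqOn k ω τ → k x < h x := by
  classical
  have hspan := hx σ subset_rfl (convexHull_subset_affineSpan _ hxσ)
  obtain ⟨b, hb, hxb⟩ := exists_mem_convexHull_insert_erase hxσ (a := a) (by simp [hspan])
  obtain ⟨τ, hτ, hτind, hxτ⟩ := exists_affineIndependent_mem_convexHull hxb
  have hτσ : ∀ e ∈ τ, e = a ∨ e ∈ σ.erase b := fun e he => Finset.mem_insert.1 (hτ he)
  refine ⟨τ, fun e he => (hτσ e he).imp_right Finset.mem_of_mem_erase, hτind, hxτ,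
    fun k hk => lt_of_not_ge fun hle => ?_⟩
  have hhk : ∀ e ∈ (τ : Set E), 0 ≤ (h - k) e := fun e he => by
    rcases hτσ e he with rfl | heσ
    · simpa [hk he] using ha.le
    · simp [hk he, hh (Finset.mem_of_mem_erase heσ)]
  have hxZ := mem_convexHull_setOf_affineMap_eq_zero hhk hxτ (by simpa using hle)
  have hZ : {e ∈ (τ : Set E) | (h - k) e = 0} ⊆ (σ.erase b : Finset E) := fun e he =>
    (hτσ e he.1).resolve_left fun hea => ha.ne' <| by
      subst hea
      exact (sub_eq_zero.1 he.2).trans (hk he.1)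
  have htop := hx _ (σ.erase_subset b) (convexHull_subset_affineSpan _ (convexHull_mono hZ hxZ))
  refine notMem_affineSpan_sdiff_singleton hσ (Finset.mem_coe.2 hb) ?_
  rw [← Finset.coe_erase, htop]
  trivial

theorem exists_isRegularCell_mem_convexHull {ω : E → 𝕜} {S : Finset E} (hω : IsGenericHeight ω S)
    {x : E} (hx : InGeneralPosition 𝕜 x S) (hxS : x ∈ convexHull 𝕜 (S : Set E)) :
    ∃ σ : Finset E, IsRegularCell ω S σ ∧ AffineIndependent 𝕜 ((↑) : σ → E) ∧
      x ∈ convexHull 𝕜 (σ : Set E) := by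
  classical
  let C := S.powerset.filter fun σ : Finset E =>
    AffineIndependent 𝕜 ((↑) : σ → E) ∧ x ∈ convexHull 𝕜 (σ : Set E)
  have hC {σ : Finset E} : σ ∈ C ↔ σ ⊆ S ∧ AffineIndependent 𝕜 ((↑) : σ → E) ∧
      x ∈ convexHull 𝕜 (σ : Set E) := by simp [C]
  have hspan : ∀ σ ∈ C, affineSpan 𝕜 (σ : Set E) = ⊤ := fun σ hσ =>
    hx σ (hC.1 hσ).1 (convexHull_subset_affineSpan _ (hC.1 hσ).2.2)
  choose! h hh using fun σ hσ => exists_affineMap_eqOn (hC.1 hσ).2.1 (hspan σ hσ) ω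
  obtain ⟨σ₀, hσ₀⟩ := exists_affineIndependent_mem_convexHull hxS
  obtain ⟨σ, hσ, hmin⟩ := C.exists_min_image (fun σ => h σ x) ⟨σ₀, hC.2 hσ₀⟩
  obtain ⟨hσS, hind, hxσ⟩ := hC.1 hσ
  refine ⟨σ, ⟨hσS, h σ, hh σ hσ, fun a haS haσ => lt_of_not_ge fun hle => ?_⟩, hind, hxσ⟩
  have hlt : ω a < h σ a := hle.lt_of_ne fun heq =>
    haσ (hω σ hσS (hspan σ hσ) (h σ) (hh σ hσ) a haS heq.symm)
  obtain ⟨τ, hτ, hτind, hxτ, hτx⟩ := exists_affineIndependent_apply_lt hind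
    (fun ρ hρ => hx ρ (hρ.trans hσS)) hxσ (hh σ hσ) hlt
  have hτC : τ ∈ C := hC.2 ⟨fun e he => (hτ e he).elim (· ▸ haS) (hσS ·), hτind, hxτ⟩
  exact (hmin τ hτC).not_gt (hτx (h τ) (hh τ hτC))

end RegularTriangulation

section Measure

variable {E : Type*} [NormedAddCommGroup E] [NormedSpace ℝ E] [FiniteDimensional ℝ E]
  [MeasurableSpace E] [BorelSpace E]

theorem ae_inGeneralPosition (μ : Measure E) [μ.IsAddHaarMeasure] (S : Finset E) :
    ∀ᵐ x ∂μ, InGeneralPosition ℝ x S := by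
  have hτ (τ : Finset E) :
      ∀ᵐ x ∂μ, x ∈ affineSpan ℝ (τ : Set E) → affineSpan ℝ (τ : Set E) = ⊤ := by
    by_cases htop : affineSpan ℝ (τ : Set E) = ⊤
    · exact .of_forall fun _ _ => htop
    · filter_upwards [measure_eq_zero_iff_ae_notMem.1 (Measure.addHaar_affineSubspace μ _ htop)]
        with x hx hxτ using absurd hxτ hx
  filter_upwards [(ae_ball_iff S.powerset.countable_toSet).2 fun τ _ => hτ τ] with x hx τ hτS
    using hx τ (Finset.mem_powerset.2 hτS)

theorem exists_measure_convexHull_eq_sum (μ : Measure E) [μ.IsAddHaarMeasure] (S : Finset E) :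
    ∃ T ⊆ S.powersetCard (Module.finrank ℝ E + 1),
      μ (convexHull ℝ (S : Set E)) = ∑ σ ∈ T, μ (convexHull ℝ (σ : Set E)) := by
  classical
  obtain ⟨ω, hω⟩ := exists_isGenericHeight (𝕜 := ℝ) S
  let T := (S.powersetCard (Module.finrank ℝ E + 1)).filter (IsRegularCell ω S)
  have hcell : ∀ σ ∈ T, IsRegularCell ω S σ := fun σ hσ => (Finset.mem_filter.1 hσ).2
  refine ⟨T, Finset.filter_subset _ _, ?_⟩
  have hdisj : (T : Set (Finset E)).Pairwise
      (Function.onFun (AEDisjoint μ) fun σ => convexHull ℝ (σ : Set E)) := fun σ hσ τ hτ hne => by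
    refine measure_eq_zero_iff_ae_notMem.2 ?_
    filter_upwards [ae_inGeneralPosition μ S] with x hx hxστ
    exact hne (isRegularCell_unique (hcell σ hσ) (hcell τ hτ) hx hxστ.1 hxστ.2)
  have hcover : convexHull ℝ (S : Set E) =ᵐ[μ] ⋃ σ ∈ T, convexHull ℝ (σ : Set E) := by
    filter_upwards [ae_inGeneralPosition μ S] with x hx
    refine propext ⟨fun hxS => ?_, fun hxT => ?_⟩
    · obtain ⟨σ, hσ, hind, hxσ⟩ := exists_isRegularCell_mem_convexHull hω hx hxS
      have hspan := hx σ hσ.1 (convexHull_subset_affineSpan _ hxσ)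
      have hcard : σ.card = Module.finrank ℝ E + 1 := by
        simpa [hspan] using hind.affineSpan_eq_top_iff_card_eq_finrank_add_one
      exact Set.mem_biUnion (Finset.mem_coe.2 <| Finset.mem_filter.2
        ⟨Finset.mem_powersetCard.2 ⟨hσ.1, hcard⟩, hσ⟩) hxσ
    · obtain ⟨σ, hσ, hxσ⟩ := Set.mem_iUnion₂.1 hxT
      exact convexHull_mono (Finset.coe_subset.2 (hcell σ hσ).1) hxσ
  rw [measure_congr hcover, measure_biUnion_finset₀ hdisj fun σ _ =>
    (σ.finite_toSet.isClosed_convexHull ℝ).measurableSet.nullMeasurableSet]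

end Measure

section SimplexVolume

/-- The simplex in `ℝ^d` cut out of the nonnegative orthant by `∑ i, x i ≤ r`. -/
def cornerSimplex (d : ℕ) (r : ℝ) : Set (Fin d → ℝ) :=
  {x | (∀ i, 0 ≤ x i) ∧ ∑ i, x i ≤ r}

theorem isClosed_cornerSimplex (d : ℕ) (r : ℝ) : IsClosed (cornerSimplex d r) :=
  (isClosed_Ici (a := (0 : Fin d → ℝ))).inter <|
    isClosed_le (f := fun x : Fin d → ℝ => ∑ i, x i) (by fun_prop) continuous_const

theorem convex_cornerSimplex (d : ℕ) (r : ℝ) : Convex ℝ (cornerSimplex d r) :=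
  (convex_Ici (0 : Fin d → ℝ)).inter <|
    convex_halfSpace_le (IsLinearMap.mk (by simp [Finset.sum_add_distrib])
      (by simp [Finset.mul_sum]) : IsLinearMap ℝ fun x : Fin d → ℝ => ∑ i, x i) r

theorem cons_mem_cornerSimplex {d : ℕ} {r t : ℝ} {y : Fin d → ℝ} :
    (Fin.cons t y : Fin (d + 1) → ℝ) ∈ cornerSimplex (d + 1) r ↔
      t ∈ Set.Icc 0 r ∧ y ∈ cornerSimplex d (r - t) := by
  simp only [cornerSimplex, Set.mem_ofPred_eq, Fin.forall_fin_succ, Fin.sum_univ_succ,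
    Fin.cons_zero, Fin.cons_succ, Set.mem_Icc, le_sub_iff_add_le']
  refine ⟨fun ⟨⟨ht, hy⟩, hsum⟩ => ⟨⟨ht, ?_⟩, hy, hsum⟩, fun ⟨⟨ht, _⟩, hy, hsum⟩ => ⟨⟨ht, hy⟩, hsum⟩⟩
  linarith [Finset.sum_nonneg fun i (_ : i ∈ Finset.univ) => hy i]

theorem volume_cornerSimplex_succ (d : ℕ) (r : ℝ) :
    volume (cornerSimplex (d + 1) r) =
      ∫⁻ t in Set.Icc 0 r, volume (cornerSimplex d (r - t)) := by
  let e := (MeasurableEquiv.piFinSuccAbove (fun _ : Fin (d + 1) => ℝ) 0).symm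
  have he : MeasurePreserving e :=
    (volume_preserving_piFinSuccAbove (fun _ : Fin (d + 1) => ℝ) 0).symm
  have hmeas := e.measurable (isClosed_cornerSimplex (d + 1) r).measurableSet
  rw [← he.measure_preimage_equiv, Measure.volume_eq_prod, Measure.prod_apply hmeas,
    ← lintegral_indicator measurableSet_Icc]
  refine lintegral_congr fun t => ?_
  have hfibre : Prod.mk t ⁻¹' (e ⁻¹' cornerSimplex (d + 1) r) =
      {y | t ∈ Set.Icc 0 r ∧ y ∈ cornerSimplex d (r - t)} := by
    ext y
    rw [Set.mem_ofPred_eq, ← cons_mem_cornerSimplex]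
    simp [e, Fin.consEquiv]
  by_cases ht : t ∈ Set.Icc 0 r <;> simp [hfibre, ht]

theorem volume_cornerSimplex (d : ℕ) {r : ℝ} (hr : 0 ≤ r) :
    volume (cornerSimplex d r) = ENNReal.ofReal (r ^ d / d !) := by
  induction d generalizing r with
  | zero => simp [cornerSimplex, hr, volume_pi]
  | succ d ih =>
    have hpos : ∀ᵐ t ∂volume.restrict (Set.Icc 0 r), 0 ≤ (r - t) ^ d / d ! := by
      filter_upwards [ae_restrict_mem measurableSet_Icc] with t ht
      have := sub_nonneg.2 ht.2
      positivity
    have hint : IntegrableOn (fun t : ℝ => (r - t) ^ d / d !) (Set.Icc 0 r) :=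
      Continuous.integrableOn_Icc (by fun_prop)
    calc volume (cornerSimplex (d + 1) r)
        = ∫⁻ t in Set.Icc 0 r, volume (cornerSimplex d (r - t)) := volume_cornerSimplex_succ d r
      _ = ∫⁻ t in Set.Icc 0 r, ENNReal.ofReal ((r - t) ^ d / d !) :=
          setLIntegral_congr_fun measurableSet_Icc fun t ht => ih (sub_nonneg.2 ht.2)
      _ = ENNReal.ofReal (∫ t in 0..r, (r - t) ^ d / d !) := by
          rw [← ofReal_integral_eq_lintegral_ofReal hint hpos, integral_Icc_eq_integral_Ioc,
            intervalIntegral.integral_of_le hr]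
      _ = ENNReal.ofReal (r ^ (d + 1) / (d + 1)!) := by
          rw [intervalIntegral.integral_div,
            intervalIntegral.integral_comp_sub_left (fun t => t ^ d) r, integral_pow, sub_self,
            sub_zero, zero_pow d.succ_ne_zero, sub_zero, div_div, Nat.factorial_succ]
          push_cast
          rfl

theorem convexHull_range_cons_zero_single (d : ℕ) :
    convexHull ℝ (Set.range (Fin.cons 0 (Pi.single · 1) : Fin (d + 1) → Fin d → ℝ)) =
      cornerSimplex d 1 := by
  set e : Fin (d + 1) → Fin d → ℝ := Fin.cons 0 (Pi.single · 1)
  refine (convexHull_min ?_ (convex_cornerSimplex d 1)).antisymm fun x hx => ?_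
  · rintro _ ⟨i, rfl⟩
    cases i using Fin.cases with
    | zero => simp [e, cornerSimplex]
    | succ i => exact ⟨(Pi.single_nonneg.2 zero_le_one : (0 : Fin d → ℝ) ≤ _), by simp [e]⟩
  · have hsum : ∑ i, (Fin.cons (1 - ∑ j, x j) x : Fin (d + 1) → ℝ) i • e i = x := by
      simp [Fin.sum_univ_succ, e, ← Pi.single_smul, Finset.univ_sum_single]
    refine hsum ▸ (convex_convexHull ℝ _).sum_mem (fun i _ => ?_) (by simp [Fin.sum_univ_succ])
      fun i _ => subset_convexHull ℝ _ (Set.mem_range_self i)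
    cases i using Fin.cases with
    | zero => simpa using hx.2
    | succ i => exact hx.1 i

theorem normalizedVolume_convexHull_range {d : ℕ} (v : Fin (d + 1) → Fin d → ℝ) :
    normalizedVolume (convexHull ℝ (Set.range v)) =
      |(Matrix.of fun i => v i.succ - v 0).det| := by
  set M : Matrix (Fin d) (Fin d) ℝ := Matrix.of fun i => v i.succ - v 0
  let f : (Fin d → ℝ) →ᵃ[ℝ] (Fin d → ℝ) := (Matrix.toLin' M.transpose).toAffineMap +
    AffineMap.const ℝ _ (v 0)
  have hf : f ∘ (Fin.cons 0 (Pi.single · 1) : Fin (d + 1) → Fin d → ℝ) = v := by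
    funext i
    cases i using Fin.cases with
    | zero => simp [f]
    | succ i => simp [f, M]
  have himage : convexHull ℝ (Set.range v) =
      (· + v 0) '' (Matrix.toLin' M.transpose '' cornerSimplex d 1) := by
    rw [Set.image_image, ← convexHull_range_cons_zero_single]
    change _ = f '' _
    rw [f.image_convexHull, ← Set.range_comp, hf]
  rw [normalizedVolume, himage, Set.image_add_right, measure_preimage_add_right,
    Measure.addHaar_image_linearMap, volume_cornerSimplex d zero_le_one,
    LinearMap.det_toLin', Matrix.det_transpose, ENNReal.toReal_mul,
    ENNReal.toReal_ofReal (abs_nonneg _), ENNReal.toReal_ofReal (by positivity), one_pow,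
    mul_left_comm, mul_one_div_cancel (Nat.cast_ne_zero.2 d.factorial_ne_zero), mul_one]

end SimplexVolume

section Index

theorem index_dvd_natAbs_det {ι M : Type*} [Fintype ι] [DecidableEq ι] [AddCommGroup M]
    (b : Module.Basis ι ℤ M) {L : AddSubgroup M} {v : ι → M} (hv : ∀ i, v i ∈ L) :
    L.index ∣ (b.det v).natAbs := by
  by_cases h : LinearIndependent ℤ v
  · let N := (Submodule.span ℤ (Set.range v)).toAddSubgroup
    have hN : N.index = (b.det v).natAbs := by
      rw [AddSubgroup.index_eq_natAbs_det b N (Module.Basis.span h)]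
      congr 2
      funext i
      rw [Module.Basis.span_apply]
    have hNL : N ≤ L := show Submodule.span ℤ (Set.range v) ≤ L.toIntSubmodule from
      Submodule.span_le.2 (Set.range_subset_iff.2 hv)
    exact hN ▸ AddSubgroup.index_dvd_of_le hNL
  · simp [b.det.map_linearDependent v h]

variable {d : ℕ} {P : Set (Fin d → ℝ)}

theorem exists_normalizedVolume_convexHull_eq_index_mul_of_card {σ : Finset (Fin d → ℝ)}
    (hσ : (σ : Set (Fin d → ℝ)) ⊆ latticeEmb d '' latticePoints P) (hcard : σ.card = d + 1) :
    ∃ n : ℕ, normalizedVolume (convexHull ℝ (σ : Set (Fin d → ℝ))) = index P * n := by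
  let e := (σ.equivFinOfCardEq hcard).symm
  choose z hzP hze using fun i => hσ (e i).2
  have hrange : Set.range (fun i => latticeEmb d (z i)) = σ := by
    simp only [hze]
    rw [← Function.comp_def, e.surjective.range_comp, Subtype.range_coe]
  have hmem (i : Fin d) :
      z i.succ - z 0 ∈ (affineLattice P).direction.toAddSubgroup :=
    AffineSubspace.vsub_mem_direction (subset_affineSpan ℤ _ (hzP i.succ))
      (subset_affineSpan ℤ _ (hzP 0))
  obtain ⟨n, hn⟩ := index_dvd_natAbs_det (Pi.basisFun ℤ (Fin d)) hmem
  refine ⟨n, ?_⟩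
  have hdet : (Matrix.of fun i => latticeEmb d (z i.succ) - latticeEmb d (z 0)).det =
      ((Pi.basisFun ℤ (Fin d)).det fun i => z i.succ - z 0 : ℤ) := by
    rw [Pi.basisFun_det_apply, Int.cast_det]
    congr 1
    ext i j
    simp [latticeEmb]
  rw [← hrange, normalizedVolume_convexHull_range, hdet, index, ← Nat.cast_mul, ← hn,
    Nat.cast_natAbs, Int.cast_abs]

theorem exists_normalizedVolume_convexHull_eq_index_mul {V : Finset (Fin d → ℝ)}
    (hV : (V : Set (Fin d → ℝ)) ⊆ latticeEmb d '' latticePoints P) :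
    ∃ n : ℕ, normalizedVolume (convexHull ℝ (V : Set (Fin d → ℝ))) = index P * n := by
  obtain ⟨T, hT, hvol⟩ := exists_measure_convexHull_eq_sum volume V
  rw [Module.finrank_fin_fun] at hT
  have hcell : ∀ σ ∈ T, ∃ n : ℕ,
      normalizedVolume (convexHull ℝ (σ : Set (Fin d → ℝ))) = index P * n := fun σ hσ => by
    obtain ⟨hσV, hcard⟩ := Finset.mem_powersetCard.1 (hT hσ)
    exact exists_normalizedVolume_convexHull_eq_index_mul_of_card
      ((Finset.coe_subset.2 hσV).trans hV) hcard
  choose! n hn using hcell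
  refine ⟨∑ σ ∈ T, n σ, ?_⟩
  have hfin : ∀ σ ∈ T, volume (convexHull ℝ (σ : Set (Fin d → ℝ))) ≠ ⊤ := fun σ _ =>
    (σ.finite_toSet.isCompact_convexHull ℝ).measure_lt_top.ne
  rw [normalizedVolume, hvol, ENNReal.toReal_sum hfin, Finset.mul_sum, Nat.cast_sum,
    Finset.mul_sum]
  exact Finset.sum_congr rfl hn

end Index

section ExtremePoints

variable {E : Type*} [AddCommGroup E] [Module ℝ E] [TopologicalSpace E] [T2Space E]
  [IsTopologicalAddGroup E] [ContinuousSMul ℝ E] [LocallyConvexSpace ℝ E] {s : Set E}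

theorem convexHull_extremePoints_convexHull (hs : s.Finite) :
    convexHull ℝ ((convexHull ℝ s).extremePoints ℝ) = convexHull ℝ s := by
  have hfin := hs.subset (extremePoints_convexHull_subset (𝕜 := ℝ))
  rw [← (hfin.isClosed_convexHull ℝ).closure_eq]
  exact closure_convexHull_extremePoints (hs.isCompact_convexHull ℝ) (convex_convexHull ℝ s)

theorem extremePoints_convexHull_of_affineIndependent (hs : s.Finite)
    (hind : AffineIndependent ℝ ((↑) : s → E)) : (convexHull ℝ s).extremePoints ℝ = s := by
  refine extremePoints_convexHull_subset.antisymm fun z hz => by_contra fun hzext => ?_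
  have hsub : (convexHull ℝ s).extremePoints ℝ ⊆ s \ {z} :=
    Set.subset_sdiff_singleton extremePoints_convexHull_subset hzext
  have hz' := subset_convexHull ℝ s hz
  rw [← convexHull_extremePoints_convexHull hs] at hz'
  exact notMem_affineSpan_sdiff_singleton hind hz
    (convexHull_subset_affineSpan _ (convexHull_mono hsub hz'))

end ExtremePoints

section AffineIndependentSubset

variable {𝕜 V P : Type*} [DivisionRing 𝕜] [AddCommGroup V] [Module 𝕜 V] [AddTorsor V P]

theorem exists_mem_affineIndependent_affineSpan_eq_top {s : Set P} (hs : affineSpan 𝕜 s = ⊤)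
    {p : P} (hp : p ∈ s) :
    ∃ t ⊆ s, p ∈ t ∧ affineSpan 𝕜 t = ⊤ ∧ AffineIndependent 𝕜 ((↑) : t → P) := by
  obtain ⟨b, hbs, hspan, hb⟩ := exists_linearIndependent 𝕜 ((· -ᵥ p) '' s)
  have hb0 : ∀ v ∈ b, v ≠ 0 := fun v hv => hb.ne_zero (⟨v, hv⟩ : b)
  rw [linearIndependent_set_iff_affineIndependent_vadd_union_singleton 𝕜 hb0 p] at hb
  refine ⟨_, Set.union_subset (Set.singleton_subset_iff.2 hp) ?_, .inl rfl,
    affineSpan_singleton_union_vadd_eq_top_of_span_eq_top p ?_, hb⟩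
  · rintro _ ⟨v, hv, rfl⟩
    obtain ⟨q, hq, rfl⟩ := hbs hv
    simpa using hq
  · rw [Subtype.range_coe, hspan, ← vectorSpan_eq_span_vsub_set_right 𝕜 hp,
      ← direction_affineSpan, hs, AffineSubspace.direction_top]

end AffineIndependentSubset

section FullMeasure

variable {E : Type*} [AddCommGroup E] [Module ℝ E] [TopologicalSpace E] [IsTopologicalAddGroup E]
  [ContinuousSMul ℝ E] [MeasurableSpace E] [OpensMeasurableSpace E]

theorem subset_of_isClosed_of_measure_le {μ : Measure E} [μ.IsOpenPosMeasure] {C K : Set E}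
    (hK : Convex ℝ K) (hint : (interior K).Nonempty) (hC : IsClosed C) (hCK : C ⊆ K)
    (hfin : μ C ≠ ⊤) (hle : μ K ≤ μ C) : K ⊆ C := by
  have hnull : μ (K \ C) = 0 := by
    rw [measure_sdiff hCK hC.measurableSet.nullMeasurableSet hfin, tsub_eq_zero_of_le hle]
  have hempty : interior K \ C = ∅ :=
    (isOpen_interior.sdiff hC).eq_empty_of_measure_zero
      (measure_mono_null (Set.sdiff_subset_sdiff_left interior_subset) hnull)
  calc K ⊆ closure K := subset_closure
    _ = closure (interior K) := (hK.closure_interior_eq_closure_of_nonempty_interior hint).symm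
    _ ⊆ C := closure_minimal (Set.sdiff_eq_empty.1 hempty) hC

end FullMeasure

section Polytope

variable {d : ℕ} {P : Set (Fin d → ℝ)}

theorem IsConvexPolytope.isCompact (hP : IsConvexPolytope P) : IsCompact P := by
  obtain ⟨S, hS, rfl⟩ := hP
  exact hS.isCompact_convexHull ℝ

theorem IsConvexPolytope.convex (hP : IsConvexPolytope P) : Convex ℝ P := by
  obtain ⟨S, -, rfl⟩ := hP
  exact convex_convexHull ℝ S

theorem IsLatticePolytope.exists_convexHull_eq (hP : IsLatticePolytope P) :
    ∃ V : Finset (Fin d → ℝ), (V : Set (Fin d → ℝ)) ⊆ latticeEmb d '' latticePoints P ∧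
      convexHull ℝ (V : Set (Fin d → ℝ)) = P := by
  obtain ⟨⟨S, hS, rfl⟩, hlattice⟩ := hP
  obtain ⟨V, hV⟩ := (hS.subset (extremePoints_convexHull_subset (𝕜 := ℝ))).exists_finset_coe
  refine ⟨V, fun x hx => ?_, hV ▸ convexHull_extremePoints_convexHull hS⟩
  rw [hV] at hx
  obtain ⟨z, rfl⟩ := hlattice hx
  exact ⟨z, hx.1, rfl⟩

theorem affineSpan_eq_top_of_normalizedVolume_ne_zero (h : normalizedVolume P ≠ 0) :
    affineSpan ℝ P = ⊤ := by
  contrapose! h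
  have hnull : volume P = 0 :=
    measure_mono_null (subset_affineSpan ℝ P) (Measure.addHaar_affineSubspace volume _ h)
  simp [normalizedVolume, hnull]

theorem IsLatticePolytope.exists_normalizedVolume_eq_index_mul (hP : IsLatticePolytope P) :
    ∃ n : ℕ, normalizedVolume P = index P * n := by
  obtain ⟨V, hV, hVP⟩ := hP.exists_convexHull_eq
  simpa only [hVP] using exists_normalizedVolume_convexHull_eq_index_mul hV

theorem convexHull_eq_of_normalizedVolume_eq_index (hP : IsConvexPolytope P)
    (hvol : normalizedVolume P = index P) {σ : Finset (Fin d → ℝ)}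
    (hσ : (σ : Set (Fin d → ℝ)) ⊆ latticeEmb d '' latticePoints P)
    (hspan : affineSpan ℝ (σ : Set (Fin d → ℝ)) = ⊤) :
    convexHull ℝ (σ : Set (Fin d → ℝ)) = P := by
  have hcompact := σ.finite_toSet.isCompact_convexHull ℝ
  have hint := interior_convexHull_nonempty_iff_affineSpan_eq_top.2 hspan
  have hsub : convexHull ℝ (σ : Set (Fin d → ℝ)) ⊆ P :=
    convexHull_min (hσ.trans (Set.image_subset_iff.2 fun _ hz => hz)) hP.convex
  have hpos : 0 < normalizedVolume (convexHull ℝ (σ : Set (Fin d → ℝ))) :=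
    mul_pos (by positivity) <| ENNReal.toReal_pos
      (Measure.measure_pos_of_nonempty_interior _ hint).ne' hcompact.measure_lt_top.ne
  have hle : normalizedVolume P ≤ normalizedVolume (convexHull ℝ (σ : Set (Fin d → ℝ))) := by
    obtain ⟨n, hn⟩ := exists_normalizedVolume_convexHull_eq_index_mul hσ
    have hn0 : n ≠ 0 := by
      rintro rfl
      simp [hn] at hpos
    rw [hvol, hn]
    exact le_mul_of_one_le_right (Nat.cast_nonneg _) (mod_cast Nat.one_le_iff_ne_zero.2 hn0)
  refine hsub.antisymm (subset_of_isClosed_of_measure_le (μ := volume) hP.convex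
    (hint.mono (interior_mono hsub)) hcompact.isClosed hsub hcompact.measure_lt_top.ne ?_)
  rw [← ENNReal.toReal_le_toReal hP.isCompact.measure_lt_top.ne hcompact.measure_lt_top.ne]
  exact le_of_mul_le_mul_left hle (by positivity)

theorem exists_affineIndependent_of_normalizedVolume_eq_index (hP : IsLatticePolytope P)
    (hvol : normalizedVolume P = index P) (hpos : normalizedVolume P ≠ 0)
    {x : Fin d → ℝ} (hx : x ∈ latticeEmb d '' latticePoints P) :
    ∃ σ : Finset (Fin d → ℝ), x ∈ σ ∧ AffineIndependent ℝ ((↑) : σ → Fin d → ℝ) ∧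
      convexHull ℝ (σ : Set (Fin d → ℝ)) = P := by
  obtain ⟨V, hV, hVP⟩ := hP.exists_convexHull_eq
  have hspan : affineSpan ℝ (latticeEmb d '' latticePoints P) = ⊤ := by
    refine top_unique ?_
    rw [← affineSpan_eq_top_of_normalizedVolume_ne_zero hpos, ← hVP, affineSpan_convexHull, hVP]
    exact affineSpan_mono ℝ hV
  obtain ⟨t, ht, hxt, htspan, hind⟩ := exists_mem_affineIndependent_affineSpan_eq_top hspan hx
  obtain ⟨σ, rfl⟩ := (finite_set_of_fin_dim_affineIndependent ℝ hind).exists_finset_coe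
  exact ⟨σ, hxt, hind, convexHull_eq_of_normalizedVolume_eq_index hP.1 hvol ht htspan⟩

theorem isEmptySimplex_of_normalizedVolume_eq_index (hP : IsLatticePolytope P)
    (hvol : normalizedVolume P = index P) (hpos : normalizedVolume P ≠ 0) :
    IsEmptySimplex P := by
  have hsimplex {x : Fin d → ℝ} (hx : x ∈ latticeEmb d '' latticePoints P) :=
    exists_affineIndependent_of_normalizedVolume_eq_index hP hvol hpos hx
  have hne : (latticeEmb d '' latticePoints P).Nonempty := by
    obtain ⟨V, hV, rfl⟩ := hP.exists_convexHull_eq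
    refine .mono hV (Set.nonempty_iff_ne_empty.2 fun hempty => hpos ?_)
    simp [hempty, normalizedVolume]
  obtain ⟨x, hx⟩ := hne
  obtain ⟨σ, hxσ, hind, hσP⟩ := hsimplex hx
  let e := σ.equivFinOfCardEq (Nat.sub_add_cancel (Finset.card_pos.2 ⟨x, hxσ⟩)).symm
  have hrange : Set.range (fun i => (e.symm i : Fin d → ℝ)) = σ := by
    rw [← Function.comp_def, e.symm.surjective.range_comp, Subtype.range_coe]
  refine ⟨hP, _, ⟨fun i => e.symm i, hind.comp_embedding e.symm.toEmbedding⟩,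
    by rw [hrange, hσP], fun z hz => ?_⟩
  obtain ⟨τ, hzτ, hτind, hτP⟩ := hsimplex ⟨z, hz, rfl⟩
  have hστ : (σ : Set (Fin d → ℝ)) = τ := by
    rw [← extremePoints_convexHull_of_affineIndependent σ.finite_toSet hind, hσP, ← hτP,
      extremePoints_convexHull_of_affineIndependent τ.finite_toSet hτind]
  rw [hrange, hστ]
  exact hzτ

end Polytope

end LatticePolytope

theorem mainTheorem2 (p : ℕ) (hp : p.Prime) (d : ℕ) (P : Set (Fin d → ℝ))
    (hP : LatticePolytope.IsLatticePolytope P)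
    (hdim : LatticePolytope.dim P = d)
    (hvol : LatticePolytope.normalizedVolume P = (p : ℝ))
    (hne : ¬ LatticePolytope.IsEmptySimplex P) :
    LatticePolytope.IsSpanning P := by
  obtain ⟨n, hn⟩ := hP.exists_normalizedVolume_eq_index_mul
  have hdvd : LatticePolytope.index P ∣ p := ⟨n, by exact_mod_cast hvol.symm.trans hn⟩
  refine ((Nat.dvd_prime hp).1 hdvd).resolve_right fun hindex => hne ?_
  refine LatticePolytope.isEmptySimplex_of_normalizedVolume_eq_index hP (by rw [hvol, hindex]) ?_
  rw [hvol]
  exact_mod_cast hp.ne_zero
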